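/- Let $(\Omega,\mathcal A,\mathbb P)$ be a probability space, let $\mathbb D,\mathbb E$ be metric spaces with metrics $d,e$, let $\mathbb D_0\subset\mathbb D$, let $g:\mathbb D_0\to\mathbb E$ be a fixed map, and let $X_n:\Omega\to\mathbb D$ ($n\in\mathbb N$) be arbitrary (not necessarily measurable) maps. Let $X$ be a Borel measurable map on a probability space with values in $\mathbb D_0$; in (i) below this space may differ from $\Omega$, in (ii) and (iii) it is $(\Omega,\mathcal A,\mathbb P)$. Notation. $E^*[T]=\inf\{E[U]: U\ge T,\ U \text{ measurable},\ E[U]\text{ exists}\}$ is the outer expectation, $\mathbb P^*(B)=\inf\{\mathbb P(A):A\supset B,\ A\in\mathcal A\}$ the outer probability, and $T^*$ the minimal measurable majorant of a map $T:\Omega\to[-\infty,\infty]$ (measurable, $T^*\ge T$, and $T^*\le V$ a.s. for every measurable $V$ with $V\ge T$ a.s.). For arbitrary maps $Y_n,Y$ with values in a metric space with metric $\rho$: $Y_n\leadsto Y$ means $E^*[f(Y_n)]\to E[f(Y)]$ for all bounded continuous real $f$; $Y_n\to Y$ in outer probability means $\mathbb P^*(\rho(Y_n,Y)>\delta)\to0$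 for all $\delta>0$; $Y_n\to Y$ outer almost surely means $\rho(Y_n,Y)^*\to0$ almost surely for some versions of $\rho(Y_n,Y)^*$. $X$ is separable if it lies almost surely in some separable Borel set. Suppose that one of the following conditions holds. (a) There are sets $\mathbb D_n\subset\mathbb D$ with $X_n(\omega)\in\mathbb D_n$ for all $n,\omega$, and maps $g_n(\omega):\mathbb D_n\to\mathbb E$, such that for every $\varepsilon>0$ there is a measurable $A\subset\Omega$ with $\mathbb P(A)\ge1-\varepsilon$ such that whenever $x_n\in\mathbb D_n$, $x_n\to x$ and $x\in\mathbb D_0$, one has $\sup_{\omega\in A}e(g_n(\omega)(x_n),g(x))\to0$. Moreover, $X$ is separable. (b) There are sets $\mathbb D_n(\omega)\subset\mathbb D$ with $X_n(\omega)\in\mathbb D_n(\omega)$ for all $n,\omega$, and maps $g_n(\omega):\mathbb D_n(\omega)\to\mathbb E$; $g$ is continuous on $\mathbb D_0$; and for every $\varepsilon>0$ there is a measurable $A\subset\Omega$ with $\mathbb P(A)\ge1-\varepsilon$ such that for all $n_1<n_2<\cdots$, all $\omega_{n_m}\in A$ and all $x_{n_m}\in\mathbb D_{n_m}(\omega_{n_m})$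 with $x_{n_m}\to x\in\mathbb D_0$, one has $g_{n_m}(\omega_{n_m})(x_{n_m})\to g(x)$. Write $g_n(X_n)$ for the map $\omega\mapsto g_n(\omega)(X_n(\omega))$. Then: (i) if $X_n\leadsto X$, then $g(X)$ is Borel measurable (under (a): it coincides almost surely with a Borel measurable map) and $g_n(X_n)\leadsto g(X)$; (ii) if $X_n\to X$ in outer probability, then $g_n(X_n)\to g(X)$ in outer probability; (iii) if $X_n\to X$ outer almost surely, then $g_n(X_n)\to g(X)$ outer almost surely. -/

import Mathlib

open MeasureTheory Filter Topology BoundedContinuousFunction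

noncomputable section

namespace ExtCMT

/-- Expectation of an extended-real valued map, `E[U⁺] - E[U⁻]`. It is only used when at least one
of the two terms is finite (see `ExpectationExists`). -/
def expectation {Ω : Type*} [MeasurableSpace Ω] (P : Measure Ω) (U : Ω → EReal) : EReal :=
  ((∫⁻ ω, (U ω).toENNReal ∂P : ENNReal) : EReal) - ((∫⁻ ω, (-U ω).toENNReal ∂P : ENNReal) : EReal)

/-- The expectation `E[U]` exists: `E[U⁺]` and `E[U⁻]` are not both infinite. -/
def ExpectationExists {Ω : Type*} [MeasurableSpace Ω] (P : Measure Ω) (U : Ω → EReal) : Prop :=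
  ∫⁻ ω, (U ω).toENNReal ∂P ≠ ⊤ ∨ ∫⁻ ω, (-U ω).toENNReal ∂P ≠ ⊤

/-- Outer expectation `E*[T]` of an arbitrary map `T : Ω → [-∞, ∞]`: the infimum of `E[U]` over
all measurable `U ≥ T` whose expectation exists. -/
def outerExpectation {Ω : Type*} [MeasurableSpace Ω] (P : Measure Ω) (T : Ω → EReal) : EReal :=
  sInf {r : EReal | ∃ U : Ω → EReal, Measurable U ∧ (∀ ω, T ω ≤ U ω) ∧
    ExpectationExists P U ∧ r = expectation P U}

/-- `U` is (a version of) the minimal measurable majorant `T*` of the arbitrary map `T`. -/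
structure IsMinimalMajorant {Ω : Type*} [MeasurableSpace Ω] (P : Measure Ω)
    (T U : Ω → EReal) : Prop where
  measurable : Measurable U
  le : ∀ ω, T ω ≤ U ω
  ae_le : ∀ V : Ω → EReal, Measurable V → (∀ᵐ ω ∂P, T ω ≤ V ω) → ∀ᵐ ω ∂P, U ω ≤ V ω

/-- Hoffmann-Jørgensen weak convergence `Y n ⇝ Y'` of arbitrary maps `Y n` on `(Ω, P)` to a map `Y'`
on a possibly different probability space `(Ω', P')`: `E* f(Y n) → E f(Y')` for all bounded
continuous real `f`. Measurability of the limit is always stated separately. -/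
def WeaklyConverges {Ω Ω' S : Type*} [MeasurableSpace Ω] [MeasurableSpace Ω'] [MetricSpace S]
    (P : Measure Ω) (Y : ℕ → Ω → S) (P' : Measure Ω') (Y' : Ω' → S) : Prop :=
  ∀ f : S →ᵇ ℝ, Tendsto (fun n => outerExpectation P (fun ω => ((f (Y n ω) : ℝ) : EReal))) atTop
    (𝓝 (((∫ ω, f (Y' ω) ∂P' : ℝ)) : EReal))

/-- Convergence in outer probability. In Mathlib the value `P B` at an arbitrary set `B` is the
infimum of `P A` over measurable `A ⊇ B`, that is, the outer probability of `B`. -/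
def ConvergesInOuterProbability {Ω S : Type*} [MeasurableSpace Ω] [MetricSpace S]
    (P : Measure Ω) (Y : ℕ → Ω → S) (Z : Ω → S) : Prop :=
  ∀ δ : ℝ, 0 < δ → Tendsto (fun n => P {ω | δ < dist (Y n ω) (Z ω)}) atTop (𝓝 0)

/-- Outer almost sure convergence: `d(Y n, Z)* → 0` almost surely, for some versions of the
minimal measurable majorants `d(Y n, Z)*`. -/
def ConvergesOuterAlmostSurely {Ω S : Type*} [MeasurableSpace Ω] [MetricSpace S]
    (P : Measure Ω) (Y : ℕ → Ω → S) (Z : Ω → S) : Prop :=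
  ∃ Δ : ℕ → Ω → EReal,
    (∀ n, IsMinimalMajorant P (fun ω => ((dist (Y n ω) (Z ω) : ℝ) : EReal)) (Δ n)) ∧
    ∀ᵐ ω ∂P, Tendsto (fun n => Δ n ω) atTop (𝓝 0)

/-- `X` is separable: it lies almost surely in some separable Borel set. -/
def IsSeparableVariable {Ω S : Type*} [MeasurableSpace Ω] [MetricSpace S] [MeasurableSpace S]
    (P : Measure Ω) (X : Ω → S) : Prop :=
  ∃ B : Set S, MeasurableSet B ∧ TopologicalSpace.IsSeparable B ∧ ∀ᵐ ω ∂P, X ω ∈ B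

/-- The condition on random maps `gn n ω : Dn n → E` with fixed domains: for every `ε > 0` there
is a measurable `A` with `P(A) ≥ 1 - ε` such that `gn n (x n) → g x` uniformly on `A` whenever
`x n ∈ Dn n` converges to `x ∈ D₀`. -/
def FixedDomainCondition {Ω D E : Type*} [MeasurableSpace Ω] [MetricSpace D] [MetricSpace E]
    (P : Measure Ω) (Dn : ℕ → Set D) (gn : (n : ℕ) → Ω → Dn n → E)
    (D₀ : Set D) (g : D₀ → E) : Prop :=
  ∀ ε : ℝ, 0 < ε → ∃ A : Set Ω, MeasurableSet A ∧ 1 - ε ≤ P.real A ∧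
    ∀ (x : (n : ℕ) → Dn n) (x₀ : D₀), Tendsto (fun n => (x n : D)) atTop (𝓝 (x₀ : D)) →
      TendstoUniformlyOn (fun n ω => gn n ω (x n)) (fun _ => g x₀) atTop A

/-- The condition on random maps `gn n ω : Dn n ω → E` with random domains: `g` is continuous on
`D₀`, and for every `ε > 0` there is a measurable `A` with `P(A) ≥ 1 - ε` such that along every
subsequence `φ` and all points `w m ∈ A`, one has `gn (φ m) (w m) (x m) → g x` whenever
`x m ∈ Dn (φ m) (w m)` converges to `x ∈ D₀`. -/
def RandomDomainCondition {Ω D E : Type*} [MeasurableSpace Ω] [MetricSpace D] [MetricSpace E]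
    (P : Measure Ω) (Dn : ℕ → Ω → Set D) (gn : (n : ℕ) → (ω : Ω) → Dn n ω → E)
    (D₀ : Set D) (g : D₀ → E) : Prop :=
  Continuous g ∧
  ∀ ε : ℝ, 0 < ε → ∃ A : Set Ω, MeasurableSet A ∧ 1 - ε ≤ P.real A ∧
    ∀ (φ : ℕ → ℕ), StrictMono φ → ∀ (w : ℕ → Ω), (∀ m, w m ∈ A) →
      ∀ (x : (m : ℕ) → Dn (φ m) (w m)) (x₀ : D₀),
        Tendsto (fun m => (x m : D)) atTop (𝓝 (x₀ : D)) →
        Tendsto (fun m => gn (φ m) (w m) (x m)) atTop (𝓝 (g x₀))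

end ExtCMT

end

/-!
Both conditions on the random maps imply one property relative to a Borel set `S` that contains `X`
almost surely: `g` is continuous on `D₀ ∩ S`, and outside events of small probability `gn n ω`
converges to `g` locally uniformly at each point of `D₀ ∩ S` (`LocallyUniformCondition`). For random
domains `S` is the whole space, and the property follows by choosing a violating subsequence. For
fixed domains `S` is the set of limits of sequences `x n ∈ Dn n` (`limitDomain`); a violating
subsequence can be completed to a sequence through all the domains, and `X ∈ S` almost surely:
under outer almost sure convergence this is immediate, and otherwise countably many null balls cover
the complement of `S` in a separable set carrying `X`.

The three conclusions are then drawn from this property.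

* Weak convergence. For a bounded continuous `f` on `E` and an event `A` of large probability, let
  `h k` be the `k`-Lipschitz majorant of all `f ∘ gn m ω` with `m ≥ k` and `ω ∈ A`
  (`lipschitzMajorant`). It is a bounded continuous test function on `D`, so `E* h k (X n)`
  converges to `E h k (X)`, while `limsup h k ≤ f ∘ g` on `D₀ ∩ S`. Dominated convergence gives
  `limsup E* f (gn n (X n)) ≤ E f (g X)`, and applying this to `-f` gives the reverse bound for the
  lower limit, because `-E* (-T) ≤ E* T`.
* Convergence in outer probability and outer almost surely. The error at `ω ∈ A` exceeds `δ` only if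
  `X n ω` is not close to `X ω` or `X ω` lies in a `deviationSet`. These sets decrease to the empty
  set, and they are measurable because they are relatively open in `D₀ ∩ S`. For the almost sure
  statement, bounds on measurable sets pass to the minimal measurable majorants, which exist by
  `exists_isMinimalMajorant`.
-/

namespace ExtCMT

/-! ### Minimal majorants and outer expectations of bounded maps -/

section Outer

variable {Ω : Type*} [MeasurableSpace Ω] (P : Measure Ω)

/-- Minimal measurable majorants exist: `T*` is the supremum of the rationals `q` placed on
measurable hulls of the sets `{q < T}`. -/
theorem exists_isMinimalMajorant [IsFiniteMeasure P] (T : Ω → EReal) :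
    ∃ U, IsMinimalMajorant P T U := by
  classical
  let A : ℚ → Set Ω := fun q => toMeasurable P {ω | ((q : ℝ) : EReal) < T ω}
  have hA : ∀ q, MeasurableSet (A q) := fun q => measurableSet_toMeasurable _ _
  refine ⟨fun ω => ⨆ q : ℚ, if ω ∈ A q then ((q : ℝ) : EReal) else ⊥, ?_, ?_, ?_⟩
  · exact Measurable.iSup fun q => Measurable.ite (hA q) measurable_const measurable_const
  · intro ω
    refine le_of_forall_lt fun c hc => ?_
    obtain ⟨q, hcq, hqT⟩ := EReal.lt_iff_exists_rat_btwn.1 hc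
    refine hcq.trans_le (le_iSup_of_le q ?_)
    rw [if_pos (subset_toMeasurable P {ω | ((q : ℝ) : EReal) < T ω} hqT)]
  · intro V hV hTV
    have hnull : ∀ q : ℚ, ∀ᵐ ω ∂P, ω ∈ A q → ((q : ℝ) : EReal) ≤ V ω := by
      intro q
      have hm : MeasurableSet {ω | V ω < ((q : ℝ) : EReal)} := measurableSet_lt hV measurable_const
      have h0 : P (A q ∩ {ω | V ω < ((q : ℝ) : EReal)}) = 0 := by
        rw [Measure.measure_toMeasurable_inter hm (measure_ne_top _ _)]
        refine measure_mono_null ?_ (ae_iff.1 hTV)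
        rintro ω ⟨h1, h2⟩
        exact not_le.2 (lt_trans h2 h1)
      filter_upwards [measure_eq_zero_iff_ae_notMem.1 h0] with ω hω hωA
      by_contra hlt
      exact hω ⟨hωA, not_le.1 hlt⟩
    filter_upwards [ae_all_iff.2 hnull] with ω hω
    refine iSup_le fun q => ?_
    split_ifs with h
    · exact hω q h
    · exact bot_le

variable {P}

theorem expectation_coe_of_integrable {v : Ω → ℝ} (hv : Integrable v P) :
    expectation P (fun ω => (v ω : EReal)) = ((∫ ω, v ω ∂P : ℝ) : EReal) := by
  have h1 : ∫⁻ ω, ENNReal.ofReal (v ω) ∂P ≠ ⊤ := (Integrable.lintegral_lt_top hv).ne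
  have h2 : ∫⁻ ω, ENNReal.ofReal (-v ω) ∂P ≠ ⊤ := (Integrable.lintegral_lt_top hv.neg).ne
  rw [integral_eq_lintegral_pos_part_sub_lintegral_neg_part hv]
  simp only [expectation, ← EReal.coe_neg, EReal.real_coe_toENNReal]
  rw [EReal.coe_sub, EReal.coe_ennreal_toReal h1, EReal.coe_ennreal_toReal h2]

theorem expectationExists_coe_of_integrable {v : Ω → ℝ} (hv : Integrable v P) :
    ExpectationExists P (fun ω => (v ω : EReal)) :=
  Or.inl (Integrable.lintegral_lt_top hv).ne

theorem expectation_mono_ae {U V : Ω → EReal} (h : ∀ᵐ ω ∂P, U ω ≤ V ω) :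
    expectation P U ≤ expectation P V := by
  refine EReal.sub_le_sub ?_ ?_
  · exact EReal.coe_ennreal_le_coe_ennreal_iff.2
      (lintegral_mono_ae (h.mono fun ω hω => EReal.toENNReal_le_toENNReal hω))
  · exact EReal.coe_ennreal_le_coe_ennreal_iff.2
      (lintegral_mono_ae (h.mono fun ω hω =>
        EReal.toENNReal_le_toENNReal (EReal.neg_le_neg_iff.2 hω)))

theorem integrable_of_abs_le [IsFiniteMeasure P] {v : Ω → ℝ} {C : ℝ} (hv : AEMeasurable v P)
    (hC : ∀ ω, |v ω| ≤ C) : Integrable v P :=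
  Integrable.of_bound hv.aestronglyMeasurable C (Eventually.of_forall hC)

theorem outerExpectation_le_integral {T v : Ω → ℝ} (hm : Measurable v) (hv : Integrable v P)
    (hTv : ∀ ω, T ω ≤ v ω) :
    outerExpectation P (fun ω => (T ω : EReal)) ≤ ((∫ ω, v ω ∂P : ℝ) : EReal) :=
  sInf_le ⟨fun ω => (v ω : EReal), hm.coe_real_ereal, fun ω => EReal.coe_le_coe_iff.2 (hTv ω),
    expectationExists_coe_of_integrable hv, (expectation_coe_of_integrable hv).symm⟩

/-- The outer expectation of a bounded map is the integral of its minimal measurable majorant,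
truncated so as to satisfy the same bound. -/
theorem exists_outerExpectation_eq_integral [IsFiniteMeasure P] {T : Ω → ℝ} {C : ℝ}
    (hT : ∀ ω, |T ω| ≤ C) :
    ∃ u : Ω → ℝ, Measurable u ∧ (∀ ω, T ω ≤ u ω) ∧ (∀ ω, |u ω| ≤ C) ∧
      outerExpectation P (fun ω => (T ω : EReal)) = ((∫ ω, u ω ∂P : ℝ) : EReal) := by
  obtain ⟨U, hU⟩ := exists_isMinimalMajorant P (fun ω => (T ω : EReal))
  have hlow : ∀ ω, ((-C : ℝ) : EReal) ≤ U ω := fun ω =>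
    (EReal.coe_le_coe_iff.2 (abs_le.1 (hT ω)).1).trans (hU.le ω)
  have hcoe : ∀ ω, (((min (C : EReal) (U ω)).toReal : ℝ) : EReal) = min (C : EReal) (U ω) := by
    intro ω
    refine EReal.coe_toReal ?_ ?_
    · exact ne_top_of_le_ne_top (EReal.coe_ne_top C) (min_le_left _ _)
    · refine ne_bot_of_le_ne_bot (EReal.coe_ne_bot (-C)) (le_min ?_ (hlow ω))
      exact EReal.coe_le_coe_iff.2 (by linarith [abs_nonneg (T ω), hT ω])
  have hTu : ∀ ω, T ω ≤ (min (C : EReal) (U ω)).toReal := fun ω => by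
    rw [← EReal.coe_le_coe_iff, hcoe]
    exact le_min (EReal.coe_le_coe_iff.2 (abs_le.1 (hT ω)).2) (hU.le ω)
  have hum : Measurable fun ω => (min (C : EReal) (U ω)).toReal :=
    (measurable_const.min hU.measurable).ereal_toReal
  have hub : ∀ ω, |(min (C : EReal) (U ω)).toReal| ≤ C := fun ω => by
    refine abs_le.2 ⟨(abs_le.1 (hT ω)).1.trans (hTu ω), ?_⟩
    rw [← EReal.coe_le_coe_iff, hcoe]
    exact min_le_left _ _
  have hui := integrable_of_abs_le (P := P) hum.aemeasurable hub
  refine ⟨_, hum, hTu, hub, le_antisymm (outerExpectation_le_integral hum hui hTu) ?_⟩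
  refine le_sInf ?_
  rintro r ⟨V, hV, hTV, -, rfl⟩
  rw [← expectation_coe_of_integrable hui]
  refine expectation_mono_ae ?_
  filter_upwards [hU.ae_le V hV (Eventually.of_forall hTV)] with ω hω
  rw [hcoe]
  exact (min_le_right _ _).trans hω

/-- The outer expectation of a real-valued map, as a real number; it is meaningful for bounded
maps, see `coe_outerMean`. -/
noncomputable def outerMean (P : Measure Ω) (T : Ω → ℝ) : ℝ :=
  (outerExpectation P (fun ω => (T ω : EReal))).toReal

variable [IsFiniteMeasure P]

theorem coe_outerMean {T : Ω → ℝ} {C : ℝ} (hT : ∀ ω, |T ω| ≤ C) :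
    ((outerMean P T : ℝ) : EReal) = outerExpectation P (fun ω => (T ω : EReal)) := by
  obtain ⟨u, -, -, -, h⟩ := exists_outerExpectation_eq_integral (P := P) hT
  simp [outerMean, h]

theorem exists_outerMean_eq_integral {T : Ω → ℝ} {C : ℝ} (hT : ∀ ω, |T ω| ≤ C) :
    ∃ u : Ω → ℝ, Measurable u ∧ (∀ ω, T ω ≤ u ω) ∧ (∀ ω, |u ω| ≤ C) ∧
      outerMean P T = ∫ ω, u ω ∂P := by
  obtain ⟨u, h1, h2, h3, h⟩ := exists_outerExpectation_eq_integral (P := P) hT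
  exact ⟨u, h1, h2, h3, by simp [outerMean, h]⟩

theorem outerMean_le_integral {T v : Ω → ℝ} {C : ℝ} (hT : ∀ ω, |T ω| ≤ C) (hm : Measurable v)
    (hv : Integrable v P) (hTv : ∀ ω, T ω ≤ v ω) : outerMean P T ≤ ∫ ω, v ω ∂P := by
  rw [← EReal.coe_le_coe_iff, coe_outerMean hT]
  exact outerExpectation_le_integral hm hv hTv

theorem neg_outerMean_neg_le {T : Ω → ℝ} {C : ℝ} (hT : ∀ ω, |T ω| ≤ C) :
    -outerMean P (fun ω => -T ω) ≤ outerMean P T := by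
  have hT' : ∀ ω, |(-T ω)| ≤ C := fun ω => by rw [abs_neg]; exact hT ω
  obtain ⟨u, hu, hTu, hub, h⟩ := exists_outerMean_eq_integral (P := P) hT
  obtain ⟨u', hu', hTu', hub', h'⟩ := exists_outerMean_eq_integral (P := P) hT'
  rw [h, h', neg_le_iff_add_nonneg,
    ← integral_add (integrable_of_abs_le hu.aemeasurable hub)
      (integrable_of_abs_le hu'.aemeasurable hub')]
  exact integral_nonneg fun ω => by
    change 0 ≤ u ω + u' ω
    linarith [hTu ω, hTu' ω]

/-- Changing a bounded map on a small measurable set changes its outer expectation by little. -/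
theorem outerMean_le_add_of_le_on {T T' : Ω → ℝ} {C : ℝ} (hT : ∀ ω, |T ω| ≤ C)
    (hT' : ∀ ω, |T' ω| ≤ C) {A : Set Ω} (hA : MeasurableSet A) (h : ∀ ω ∈ A, T ω ≤ T' ω) :
    outerMean P T ≤ outerMean P T' + 2 * C * P.real Aᶜ := by
  obtain ⟨u, hu, hTu, hub, he⟩ := exists_outerMean_eq_integral (P := P) hT'
  have hui := integrable_of_abs_le (P := P) hu.aemeasurable hub
  have hind : Integrable (Aᶜ.indicator fun _ : Ω => 2 * C) P :=
    (integrable_const _).indicator hA.compl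
  have hint : ∫ ω, (u ω + Aᶜ.indicator (fun _ => 2 * C) ω) ∂P
      = outerMean P T' + 2 * C * P.real Aᶜ := by
    rw [integral_add hui hind, integral_indicator_const _ hA.compl, he, smul_eq_mul, mul_comm]
  rw [← hint]
  refine outerMean_le_integral hT
    (hu.add (measurable_const.indicator hA.compl)) (hui.add hind) fun ω => ?_
  by_cases hω : ω ∈ A
  · have : ω ∉ Aᶜ := fun h' => h' hω
    simpa [this] using (h ω hω).trans (hTu ω)
  · have : ω ∈ Aᶜ := hω
    simp only [Set.indicator_of_mem this]
    linarith [(abs_le.1 (hT ω)).2, (abs_le.1 (hub ω)).1]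

theorem weaklyConverges_iff_outerMean {Ω' S : Type*} [MeasurableSpace Ω'] [MetricSpace S]
    {P' : Measure Ω'} {Y : ℕ → Ω → S} {Y' : Ω' → S} :
    WeaklyConverges P Y P' Y' ↔ ∀ f : S →ᵇ ℝ,
      Tendsto (fun n => outerMean P fun ω => f (Y n ω)) atTop (𝓝 (∫ ω, f (Y' ω) ∂P')) := by
  refine forall_congr' fun f => ?_
  rw [← EReal.tendsto_coe]
  refine iff_of_eq (congrArg (fun s => Tendsto s atTop _) (funext fun n => ?_))
  exact (coe_outerMean fun ω => f.norm_coe_le_norm (Y n ω)).symm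

/-- One-sided bounds suffice for weak convergence, because `-E*(-T) ≤ E* T`. -/
theorem weaklyConverges_of_eventually_le {Ω' S : Type*} [MeasurableSpace Ω'] [MetricSpace S]
    {P' : Measure Ω'} {Y : ℕ → Ω → S} {Y' : Ω' → S}
    (h : ∀ f : S →ᵇ ℝ, ∀ η > 0, ∀ᶠ n in atTop,
      outerMean P (fun ω => f (Y n ω)) ≤ ∫ ω, f (Y' ω) ∂P' + η) :
    WeaklyConverges P Y P' Y' := by
  refine weaklyConverges_iff_outerMean.2 fun f => tendsto_order.2 ⟨fun a ha => ?_, fun a ha => ?_⟩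
  · filter_upwards [h (-f) ((∫ ω, f (Y' ω) ∂P' - a) / 2) (by linarith)] with n hn
    have h1 := neg_outerMean_neg_le (P := P) fun ω => f.norm_coe_le_norm (Y n ω)
    simp only [BoundedContinuousFunction.coe_neg, Pi.neg_apply, integral_neg] at hn
    linarith
  · filter_upwards [h f ((a - ∫ ω, f (Y' ω) ∂P') / 2) (by linarith)] with n hn
    linarith

end Outer

/-! ### Local uniform convergence of random maps -/

section LocallyUniform

variable {Ω D E : Type*} [MetricSpace D] [MetricSpace E] {D₀ : Set D}

/-- The random maps `gn n ω`, for `ω ∈ A`, converge to `g` locally uniformly at `x₀`: for large `n`,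
all values of `gn n ω` at points near `x₀` are near `g x₀`, uniformly in `ω ∈ A`. The same `k`
bounds both the index and the radius. -/
def LocallyUniformAt (Dn : ℕ → Ω → Set D) (gn : (n : ℕ) → (ω : Ω) → Dn n ω → E) (g : D₀ → E)
    (A : Set Ω) (x₀ : D₀) : Prop :=
  ∀ η : ℝ, 0 < η → ∃ k : ℕ, ∀ m, k ≤ m → ∀ ω ∈ A, ∀ y : Dn m ω,
    dist (y : D) x₀ < 1 / ((k : ℝ) + 1) → dist (gn m ω y) (g x₀) < η

/-- The common form of both conditions on the random maps, relative to a set `S` of good limit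
points: `g` is continuous on `D₀ ∩ S`, and outside events of arbitrarily small probability the maps
converge locally uniformly at every point of `D₀ ∩ S`. -/
def LocallyUniformCondition [MeasurableSpace Ω] (P : Measure Ω) (Dn : ℕ → Ω → Set D)
    (gn : (n : ℕ) → (ω : Ω) → Dn n ω → E) (g : D₀ → E) (S : Set D) : Prop :=
  ContinuousOn g {x | (x : D) ∈ S} ∧
  ∀ ε : ℝ, 0 < ε → ∃ A : Set Ω, MeasurableSet A ∧ 1 - ε ≤ P.real A ∧
    ∀ x₀ : D₀, (x₀ : D) ∈ S → LocallyUniformAt Dn gn g A x₀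

variable {Dn : ℕ → Ω → Set D} {gn : (n : ℕ) → (ω : Ω) → Dn n ω → E} {g : D₀ → E} {A : Set Ω}

theorem LocallyUniformAt.of_seq {x₀ : D₀}
    (h : ∀ φ : ℕ → ℕ, StrictMono φ → ∀ w : ℕ → Ω, (∀ m, w m ∈ A) →
      ∀ x : (m : ℕ) → Dn (φ m) (w m), Tendsto (fun m => (x m : D)) atTop (𝓝 (x₀ : D)) →
        Tendsto (fun m => gn (φ m) (w m) (x m)) atTop (𝓝 (g x₀))) :
    LocallyUniformAt Dn gn g A x₀ := by
  intro η hη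
  by_contra! hc
  choose m hm w hw y hy hyη using hc
  obtain ⟨ψ, hψ, hmψ⟩ := strictMono_subseq_of_id_le hm
  have hlim : Tendsto (fun j => (y (ψ j) : D)) atTop (𝓝 (x₀ : D)) := by
    refine tendsto_iff_dist_tendsto_zero.2 (squeeze_zero (fun _ => dist_nonneg)
      (fun j => (hy (ψ j)).le) ?_)
    exact tendsto_one_div_add_atTop_nhds_zero_nat.comp hψ.tendsto_atTop
  have h1 := h (m ∘ ψ) hmψ (w ∘ ψ) (fun j => hw _) (fun j => y (ψ j)) hlim
  obtain ⟨j, hj⟩ := ((tendsto_iff_dist_tendsto_zero.1 h1).eventually_lt_const hη).exists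
  exact absurd hj (not_lt.2 (hyη (ψ j)))

/-! ### Lipschitz majorants of random compositions -/

/-- The `k`-Lipschitz function lying above all `f ∘ gn m ω` with `m ≥ k` and `ω ∈ A`: the supremum
of the cones of slope `k` with apexes on their graphs, cut off at `-‖f‖`. If there are no such maps,
the supremum is `0`, which respects the bounds below as well. -/
noncomputable def lipschitzMajorant (gn : (n : ℕ) → (ω : Ω) → Dn n ω → E) (A : Set Ω) (f : E →ᵇ ℝ)
    (k : ℕ) (x : D) : ℝ :=
  ⨆ p : {p : Σ (m : ℕ) (ω : Ω), Dn m ω // k ≤ p.1 ∧ p.2.1 ∈ A},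
    max (-‖f‖) (f (gn p.1.1 p.1.2.1 p.1.2.2) - k * dist x p.1.2.2)

theorem lipschitzMajorant_term_le (f : E →ᵇ ℝ) (k : ℕ) (x : D) (y : D) (z : E) :
    max (-‖f‖) (f z - k * dist x y) ≤ ‖f‖ := by
  refine max_le (by linarith [norm_nonneg f]) ?_
  have := (abs_le.1 (f.norm_coe_le_norm z)).2
  have h2 : 0 ≤ (k : ℝ) * dist x y := by positivity
  linarith

theorem bddAbove_lipschitzMajorant (f : E →ᵇ ℝ) (k : ℕ) (x : D) :
    BddAbove (Set.range fun p : {p : Σ (m : ℕ) (ω : Ω), Dn m ω // k ≤ p.1 ∧ p.2.1 ∈ A} =>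
      max (-‖f‖) (f (gn p.1.1 p.1.2.1 p.1.2.2) - k * dist x p.1.2.2)) := by
  refine ⟨‖f‖, ?_⟩
  rintro _ ⟨p, rfl⟩
  exact lipschitzMajorant_term_le f k x _ _

theorem le_lipschitzMajorant (f : E →ᵇ ℝ) {k m : ℕ} (hkm : k ≤ m) {ω : Ω} (hω : ω ∈ A)
    (y : Dn m ω) : f (gn m ω y) ≤ lipschitzMajorant gn A f k (y : D) := by
  refine le_trans ?_ (le_ciSup (bddAbove_lipschitzMajorant f k (y : D)) ⟨⟨m, ω, y⟩, hkm, hω⟩)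
  simp

theorem abs_lipschitzMajorant_le (f : E →ᵇ ℝ) (k : ℕ) (x : D) :
    |lipschitzMajorant gn A f k x| ≤ ‖f‖ := by
  refine abs_le.2 ⟨?_, Real.iSup_le (fun p => lipschitzMajorant_term_le f k x _ _) (norm_nonneg f)⟩
  rcases isEmpty_or_nonempty {p : Σ (m : ℕ) (ω : Ω), Dn m ω // k ≤ p.1 ∧ p.2.1 ∈ A} with h | ⟨⟨p⟩⟩
  · simp [lipschitzMajorant, Real.iSup_of_isEmpty]
  · exact le_ciSup_of_le (bddAbove_lipschitzMajorant f k x) p (le_max_left _ _)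

theorem lipschitzWith_lipschitzMajorant (f : E →ᵇ ℝ) (k : ℕ) :
    LipschitzWith k (lipschitzMajorant gn A f k) := by
  refine LipschitzWith.of_le_add_mul k fun x y => ?_
  rcases isEmpty_or_nonempty {p : Σ (m : ℕ) (ω : Ω), Dn m ω // k ≤ p.1 ∧ p.2.1 ∈ A} with h | h
  · simp only [lipschitzMajorant, Real.iSup_of_isEmpty]
    positivity
  · refine ciSup_le fun p => ?_
    have h1 := le_ciSup (bddAbove_lipschitzMajorant (gn := gn) f k y) p
    have h2 : (k : ℝ) * dist y p.1.2.2 ≤ k * (dist x y + dist x p.1.2.2) := by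
      rw [dist_comm x y]
      exact mul_le_mul_of_nonneg_left (dist_triangle _ _ _) (by positivity)
    have h3 : 0 ≤ (k : ℝ) * dist x y := by positivity
    change _ ≤ lipschitzMajorant gn A f k y at h1
    refine max_le ?_ ?_
    · have := (le_max_left _ _).trans h1
      push_cast
      linarith
    · have := (le_max_right _ _).trans h1
      push_cast
      linarith

theorem eventually_lipschitzMajorant_le {x₀ : D₀} (h : LocallyUniformAt Dn gn g A x₀)
    (hne : ∀ m, ∃ ω ∈ A, (Dn m ω).Nonempty) (f : E →ᵇ ℝ) {r : ℝ} (hr : f (g x₀) < r) :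
    ∀ᶠ k in atTop, lipschitzMajorant gn A f k (x₀ : D) ≤ r := by
  obtain ⟨η, hη, hball⟩ := Metric.eventually_nhds_iff.1
    (f.continuous.continuousAt.eventually_lt_const hr)
  obtain ⟨k₀, hk₀⟩ := h η hη
  have hfr : -‖f‖ ≤ r := (abs_le.1 (f.norm_coe_le_norm (g x₀))).1.trans hr.le
  filter_upwards [eventually_ge_atTop k₀,
    eventually_ge_atTop ⌈2 * ‖f‖ * ((k₀ : ℝ) + 1)⌉₊] with k hk hkC
  obtain ⟨ω₀, hω₀, y₀, hy₀⟩ := hne k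
  have : Nonempty {p : Σ (m : ℕ) (ω : Ω), Dn m ω // k ≤ p.1 ∧ p.2.1 ∈ A} :=
    ⟨⟨⟨k, ω₀, ⟨y₀, hy₀⟩⟩, le_rfl, hω₀⟩⟩
  refine ciSup_le fun ⟨⟨m, ω, y⟩, hkm, hω⟩ => max_le hfr ?_
  have hfy := (abs_le.1 (f.norm_coe_le_norm (gn m ω y))).2
  rcases lt_or_ge (dist (y : D) x₀) (1 / ((k₀ : ℝ) + 1)) with hd | hd
  · have h1 := hball (hk₀ m (hk.trans hkm) ω hω y hd)
    have h2 : 0 ≤ (k : ℝ) * dist (x₀ : D) y := by positivity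
    change f (gn m ω y) - k * dist (x₀ : D) y ≤ r
    linarith
  -- far apexes are harmless: the slope has already brought the cone below `-‖f‖`
  · have h1 : 2 * ‖f‖ ≤ k * dist (x₀ : D) y := by
      have hk' : 2 * ‖f‖ * ((k₀ : ℝ) + 1) ≤ k := Nat.ceil_le.1 hkC
      have hpos : (0 : ℝ) < (k₀ : ℝ) + 1 := by positivity
      calc 2 * ‖f‖ = 2 * ‖f‖ * ((k₀ : ℝ) + 1) * (1 / ((k₀ : ℝ) + 1)) := by field_simp
        _ ≤ k * dist (x₀ : D) y := by
            rw [dist_comm]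
            exact mul_le_mul hk' hd (by positivity) (by positivity)
    change f (gn m ω y) - k * dist (x₀ : D) y ≤ r
    linarith

/-! ### Deviation sets -/

/-- The points of `D₀ ∩ S` near which some `gn m ω`, with `m ≥ k` and `ω ∈ A`, is more than `δ` away
from `g`. -/
def deviationSet (gn : (n : ℕ) → (ω : Ω) → Dn n ω → E) (g : D₀ → E) (A : Set Ω) (S : Set D)
    (δ : ℝ) (k : ℕ) : Set D₀ :=
  {x | (x : D) ∈ S ∧ ∃ m, k ≤ m ∧ ∃ ω ∈ A, ∃ y : Dn m ω,
    dist (y : D) x < 1 / ((k : ℝ) + 1) ∧ δ < dist (gn m ω y) (g x)}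

theorem antitone_deviationSet (S : Set D) (δ : ℝ) : Antitone (deviationSet gn g A S δ) := by
  rintro k l hkl x ⟨hxS, m, hm, ω, hω, y, hd, hδ⟩
  refine ⟨hxS, m, hkl.trans hm, ω, hω, y, hd.trans_le ?_, hδ⟩
  exact one_div_le_one_div_of_le (by positivity) (by exact_mod_cast Nat.succ_le_succ hkl)

theorem exists_notMem_deviationSet {S : Set D} {δ : ℝ} (hδ : 0 < δ) {x₀ : D₀}
    (h : (x₀ : D) ∈ S → LocallyUniformAt Dn gn g A x₀) :
    ∃ k, x₀ ∉ deviationSet gn g A S δ k := by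
  by_cases hS : (x₀ : D) ∈ S
  · obtain ⟨k, hk⟩ := h hS δ hδ
    refine ⟨k, ?_⟩
    rintro ⟨-, m, hm, ω, hω, y, hd, hlt⟩
    exact lt_asymm hlt (hk m hm ω hω y hd)
  · exact ⟨0, fun h' => hS h'.1⟩

/-- Deviation sets are relatively open in `D₀ ∩ S`, because `g` is continuous there; this is what
makes them measurable although the maps `gn n ω` are arbitrary. -/
theorem measurableSet_deviationSet [MeasurableSpace D] [BorelSpace D] {S : Set D}
    (hS : MeasurableSet S) (hg : ContinuousOn g {x | (x : D) ∈ S}) (δ : ℝ) (k : ℕ) :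
    MeasurableSet (deviationSet gn g A S δ k) := by
  have hopen : ∀ p : Σ (m : ℕ) (ω : Ω), Dn m ω, ∃ u : Set D₀, IsOpen u ∧
      {x : D₀ | δ < dist (gn p.1 p.2.1 p.2.2) (g x)} ∩ {x | (x : D) ∈ S}
        = u ∩ {x | (x : D) ∈ S} := fun p =>
    continuousOn_iff'.1 ((continuous_const.dist continuous_id).comp_continuousOn hg :
      ContinuousOn (fun x => dist (gn p.1 p.2.1 p.2.2) (g x)) _) (Set.Ioi δ) isOpen_Ioi
  choose u hu hus using hopen
  have heq : deviationSet gn g A S δ k =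
      (⋃ p : {p : Σ (m : ℕ) (ω : Ω), Dn m ω // k ≤ p.1 ∧ p.2.1 ∈ A},
        {x : D₀ | dist (p.1.2.2 : D) x < 1 / ((k : ℝ) + 1)} ∩ u p.1) ∩ {x | (x : D) ∈ S} := by
    ext x
    simp only [deviationSet, Set.mem_inter_iff, Set.mem_iUnion, Set.mem_ofPred_eq]
    constructor
    · rintro ⟨hxS, m, hm, ω, hω, y, hd, hlt⟩
      exact ⟨⟨⟨⟨m, ω, y⟩, hm, hω⟩, hd, ((hus ⟨m, ω, y⟩).subset ⟨hlt, hxS⟩).1⟩, hxS⟩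
    · rintro ⟨⟨⟨⟨m, ω, y⟩, hm, hω⟩, hd, hxu⟩, hxS⟩
      exact ⟨hxS, m, hm, ω, hω, y, hd, ((hus ⟨m, ω, y⟩).superset ⟨hxu, hxS⟩).1⟩
  rw [heq]
  refine MeasurableSet.inter (IsOpen.measurableSet (isOpen_iUnion fun p => ?_))
    (measurable_subtype_coe hS)
  exact (isOpen_lt (continuous_const.dist continuous_subtype_val) continuous_const).inter (hu _)

theorem measurableSet_preimage_deviationSet {Ω' : Type*} [MeasurableSpace Ω'] [MeasurableSpace D]
    [BorelSpace D] {S : Set D} (hS : MeasurableSet S)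
    (hg : ContinuousOn g {x | (x : D) ∈ S}) {X : Ω' → D} (hX : ∀ ω, X ω ∈ D₀) (hXm : Measurable X)
    (δ : ℝ) (k : ℕ) :
    MeasurableSet {ω | (⟨X ω, hX ω⟩ : D₀) ∈ deviationSet gn g A S δ k} :=
  hXm.subtype_mk (measurableSet_deviationSet hS hg δ k)

theorem dist_le_of_notMem_deviationSet {Xn : ℕ → Ω → D} {X : Ω → D} {S : Set D}
    (hX : ∀ ω, X ω ∈ D₀)
    (hXn : ∀ n ω, Xn n ω ∈ Dn n ω) {δ : ℝ} {k n : ℕ} (hkn : k ≤ n) {ω : Ω} (hω : ω ∈ A)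
    (hS : X ω ∈ S) (hk : (⟨X ω, hX ω⟩ : D₀) ∉ deviationSet gn g A S δ k)
    (hd : dist (Xn n ω) (X ω) < 1 / ((k : ℝ) + 1)) :
    dist (gn n ω ⟨Xn n ω, hXn n ω⟩) (g ⟨X ω, hX ω⟩) ≤ δ := by
  by_contra! hlt
  exact hk ⟨hS, n, hkn, ω, hω, ⟨Xn n ω, hXn n ω⟩, hd, hlt⟩

end LocallyUniform

/-! ### Transfer of convergence under the locally uniform condition -/

section Core

variable {Ω Ω' D E : Type*} [MeasurableSpace Ω] {P : Measure Ω}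
  [MeasurableSpace Ω'] {P' : Measure Ω'}
  [MetricSpace D] [MeasurableSpace D] [BorelSpace D]
  [MetricSpace E]
  {D₀ : Set D} {g : D₀ → E} {Xn : ℕ → Ω → D} {Dn : ℕ → Ω → Set D}
  {gn : (n : ℕ) → (ω : Ω) → Dn n ω → E} {S : Set D}

/-- If `g` is continuous on `D₀ ∩ S` then `g ∘ X` is almost everywhere measurable as soon as `X`
takes values in `D₀` everywhere and in `S` almost everywhere; `D₀` need not be measurable. -/
theorem aemeasurable_comp_of_continuousOn [MeasurableSpace E] [BorelSpace E]
    (hS : MeasurableSet S) (hg : ContinuousOn g {x | (x : D) ∈ S})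
    {X : Ω' → D} (hX : ∀ ω, X ω ∈ D₀) (hXm : Measurable X) (hXS : ∀ᵐ ω ∂P', X ω ∈ S) :
    AEMeasurable (fun ω => g ⟨X ω, hX ω⟩) P' := by
  have hmeas : Measurable fun x : {x : D₀ | (x : D) ∈ S} => g x :=
    (continuousOn_iff_continuous_domRestrict.1 hg).measurable
  rw [← Measure.restrict_eq_self_of_ae_mem (s := X ⁻¹' S) hXS]
  refine aemeasurable_restrict_of_measurable_subtype (hXm hS) ?_
  have h2 : Measurable fun ω : X ⁻¹' S =>
      (⟨⟨X ω, hX ω⟩, ω.2⟩ : {x : D₀ | (x : D) ∈ S}) :=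
    ((hXm.comp measurable_subtype_coe).subtype_mk).subtype_mk
  exact hmeas.comp h2

theorem measureReal_compl_le [IsProbabilityMeasure P] {A : Set Ω} (hA : MeasurableSet A) {ε : ℝ}
    (h : 1 - ε ≤ P.real A) : P.real Aᶜ ≤ ε := by
  rw [probReal_compl_eq_one_sub hA]
  linarith

theorem LocallyUniformCondition.weaklyConverges [IsProbabilityMeasure P] [IsProbabilityMeasure P']
    [MeasurableSpace E] [BorelSpace E]
    (h : LocallyUniformCondition P Dn gn g S) (hS : MeasurableSet S) (hXn : ∀ n ω, Xn n ω ∈ Dn n ω)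
    {X : Ω' → D} (hX : ∀ ω, X ω ∈ D₀) (hXm : Measurable X) (hXS : ∀ᵐ ω ∂P', X ω ∈ S)
    (hw : WeaklyConverges P Xn P' X) :
    WeaklyConverges P (fun n ω => gn n ω ⟨Xn n ω, hXn n ω⟩) P' (fun ω => g ⟨X ω, hX ω⟩) := by
  refine weaklyConverges_of_eventually_le fun f η hη => ?_
  have hC : 0 ≤ ‖f‖ := norm_nonneg f
  -- the bound `1 / 2` makes `A` nonempty, the other one makes the contribution of `Aᶜ` small
  obtain ⟨A, hA, hPA, hL⟩ := h.2 (min (1 / 2) (η / (6 * (‖f‖ + 1)))) (by positivity)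
  have hPAc := measureReal_compl_le hA hPA
  have hsmall : 2 * ‖f‖ * P.real Aᶜ ≤ η / 3 := by
    calc 2 * ‖f‖ * P.real Aᶜ ≤ 2 * (‖f‖ + 1) * (η / (6 * (‖f‖ + 1))) := by
          refine mul_le_mul (by linarith) (hPAc.trans (min_le_right _ _)) measureReal_nonneg
            (by linarith)
      _ = η / 3 := by field_simp; norm_num
  have hne : A.Nonempty := by
    refine nonempty_of_measureReal_ne_zero (μ := P) (ne_of_gt ?_)
    linarith [min_le_left (1 / 2 : ℝ) (η / (6 * (‖f‖ + 1)))]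
  have hne' : ∀ m, ∃ ω ∈ A, (Dn m ω).Nonempty := fun m =>
    hne.elim fun ω hω => ⟨ω, hω, _, hXn m ω⟩
  have hfg : AEMeasurable (fun ω => f (g ⟨X ω, hX ω⟩)) P' :=
    f.continuous.measurable.comp_aemeasurable
      (aemeasurable_comp_of_continuousOn hS h.1 hX hXm hXS)
  have hcont : ∀ k, Continuous (lipschitzMajorant gn A f k) := fun k =>
    (lipschitzWith_lipschitzMajorant f k).continuous
  have hhm : ∀ k, Measurable fun ω => lipschitzMajorant gn A f k (X ω) := fun k =>
    (hcont k).measurable.comp hXm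
  -- the maximum with the limit makes a one-sided pointwise bound on the majorants sufficient
  have hlim : Tendsto
      (fun k => ∫ ω, max (lipschitzMajorant gn A f k (X ω)) (f (g ⟨X ω, hX ω⟩)) ∂P')
      atTop (𝓝 (∫ ω, f (g ⟨X ω, hX ω⟩) ∂P')) := by
    refine tendsto_integral_of_dominated_convergence (fun _ => ‖f‖)
      (fun k => ((hhm k).aemeasurable.max hfg).aestronglyMeasurable) (integrable_const _) ?_ ?_
    · exact fun k => Eventually.of_forall fun ω => abs_max_le_max_abs_abs.trans
        (max_le (abs_lipschitzMajorant_le f k _) (f.norm_coe_le_norm _))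
    · filter_upwards [hXS] with ω hω
      refine tendsto_order.2 ⟨fun a ha => Eventually.of_forall fun k =>
        ha.trans_le (le_max_right _ _), fun a ha => ?_⟩
      obtain ⟨b, hb, hba⟩ := exists_between ha
      filter_upwards [eventually_lipschitzMajorant_le (hL ⟨X ω, hX ω⟩ hω) hne' f hb] with k hk
      exact (max_le hk hb.le).trans_lt hba
  obtain ⟨k, hk⟩ := (hlim.eventually_lt_const
    (lt_add_of_pos_right _ (by positivity : 0 < η / 3))).exists
  have hk' : ∫ ω, lipschitzMajorant gn A f k (X ω) ∂P' ≤ ∫ ω, f (g ⟨X ω, hX ω⟩) ∂P' + η / 3 := by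
    refine le_trans (integral_mono ?_ ?_ fun ω => le_max_left _ _) hk.le
    · exact integrable_of_abs_le (hhm k).aemeasurable fun ω => abs_lipschitzMajorant_le f k _
    · exact integrable_of_abs_le ((hhm k).aemeasurable.max hfg) fun ω =>
        abs_max_le_max_abs_abs.trans
          (max_le (abs_lipschitzMajorant_le f k _) (f.norm_coe_le_norm _))
  have hn := weaklyConverges_iff_outerMean.1 hw
    (BoundedContinuousFunction.ofNormedAddCommGroup (lipschitzMajorant gn A f k) (hcont k) ‖f‖
      (abs_lipschitzMajorant_le f k))
  filter_upwards [eventually_ge_atTop k, hn.eventually_lt_const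
    (lt_add_of_pos_right _ (by positivity : 0 < η / 3))] with n hkn hn
  simp only [BoundedContinuousFunction.coe_ofNormedAddCommGroup] at hn
  have := outerMean_le_add_of_le_on (P := P) (T := fun ω => f (gn n ω ⟨Xn n ω, hXn n ω⟩))
    (T' := fun ω => lipschitzMajorant gn A f k (Xn n ω)) (fun ω => f.norm_coe_le_norm _)
    (fun ω => abs_lipschitzMajorant_le f k _) hA
    (fun ω hω => le_lipschitzMajorant f hkn hω ⟨Xn n ω, hXn n ω⟩)
  linarith

theorem LocallyUniformCondition.convergesInOuterProbability [IsProbabilityMeasure P]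
    (h : LocallyUniformCondition P Dn gn g S) (hS : MeasurableSet S) (hXn : ∀ n ω, Xn n ω ∈ Dn n ω)
    {X : Ω → D} (hX : ∀ ω, X ω ∈ D₀) (hXm : Measurable X) (hXS : ∀ᵐ ω ∂P, X ω ∈ S)
    (hp : ConvergesInOuterProbability P Xn X) :
    ConvergesInOuterProbability P (fun n ω => gn n ω ⟨Xn n ω, hXn n ω⟩)
      (fun ω => g ⟨X ω, hX ω⟩) := by
  intro δ hδ
  refine ENNReal.tendsto_nhds_zero.2 fun ε hε => ?_
  obtain ⟨e, he, heε⟩ := ENNReal.lt_iff_exists_nnreal_btwn.1 hε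
  have he' : (0 : ℝ) < e := by exact_mod_cast he
  obtain ⟨A, hA, hPA, hL⟩ := h.2 (e / 3) (by positivity)
  have hPAc : P Aᶜ ≤ ENNReal.ofReal (e / 3) := by
    rw [← ofReal_measureReal]
    exact ENNReal.ofReal_le_ofReal (measureReal_compl_le hA hPA)
  have hpos : 0 < ENNReal.ofReal (e / 3) := ENNReal.ofReal_pos.2 (by positivity)
  let G : ℕ → Set Ω := fun k => {ω | (⟨X ω, hX ω⟩ : D₀) ∈ deviationSet gn g A S δ k}
  have hG : Tendsto (fun k => P (G k)) atTop (𝓝 0) := by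
    have h1 := tendsto_measure_iInter_atTop (μ := P) (s := G)
      (fun k => (measurableSet_preimage_deviationSet hS h.1 hX hXm δ k).nullMeasurableSet)
      (fun k l hkl ω hω => antitone_deviationSet S δ hkl hω) ⟨0, measure_ne_top _ _⟩
    have h2 : ⋂ k, G k = ∅ := by
      refine Set.eq_empty_of_forall_notMem fun ω hω => ?_
      obtain ⟨k, hk⟩ := exists_notMem_deviationSet hδ (hL ⟨X ω, hX ω⟩)
      exact hk (Set.mem_iInter.1 hω k)
    rwa [h2, measure_empty] at h1
  obtain ⟨k, hk⟩ := (hG.eventually_lt_const hpos).exists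
  filter_upwards [eventually_ge_atTop k, (hp (1 / (2 * ((k : ℝ) + 1)))
    (by positivity)).eventually_lt_const hpos] with n hkn hn
  have hsub : {ω | δ < dist (gn n ω ⟨Xn n ω, hXn n ω⟩) (g ⟨X ω, hX ω⟩)} ⊆
      ((Aᶜ ∪ G k) ∪ {ω | 1 / (2 * ((k : ℝ) + 1)) < dist (Xn n ω) (X ω)}) ∪ {ω | X ω ∉ S} := by
    intro ω hω
    by_contra hc
    simp only [Set.mem_union, not_or, Set.mem_compl_iff, not_not] at hc
    obtain ⟨⟨⟨hωA, hωG⟩, hωd⟩, hωS⟩ := hc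
    refine absurd hω (not_lt.2 (dist_le_of_notMem_deviationSet hX hXn hkn hωA
      (not_not.1 hωS) hωG ((not_lt.1 hωd).trans_lt ?_)))
    exact one_div_lt_one_div_of_lt (by positivity) (by linarith [k.cast_nonneg (α := ℝ)])
  calc P {ω | δ < dist (gn n ω ⟨Xn n ω, hXn n ω⟩) (g ⟨X ω, hX ω⟩)}
      ≤ ((P Aᶜ + P (G k)) + P {ω | 1 / (2 * ((k : ℝ) + 1)) < dist (Xn n ω) (X ω)})
          + P {ω | X ω ∉ S} := by
        refine (measure_mono hsub).trans ((measure_union_le _ _).trans ?_)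
        gcongr
        refine (measure_union_le _ _).trans ?_
        gcongr
        exact measure_union_le _ _
    _ ≤ ((ENNReal.ofReal (e / 3) + ENNReal.ofReal (e / 3)) + ENNReal.ofReal (e / 3)) + 0 :=
        add_le_add (add_le_add (add_le_add hPAc hk.le) hn.le) (le_of_eq (ae_iff.1 hXS))
    _ = e := by
        rw [add_zero, ← ENNReal.ofReal_add (by positivity) (by positivity),
          ← ENNReal.ofReal_add (by positivity) (by positivity), ← ENNReal.ofReal_coe_nnreal]
        congr 1
        ring
    _ ≤ ε := heε.le

/-- On a measurable set, a minimal measurable majorant inherits upper bounds by constants. -/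
theorem IsMinimalMajorant.ae_le_const_on {T U : Ω → EReal} (hU : IsMinimalMajorant P T U)
    {C : Set Ω} (hC : MeasurableSet C) {c : EReal} (h : ∀ ω ∈ C, T ω ≤ c) :
    ∀ᵐ ω ∂P, ω ∈ C → U ω ≤ c := by
  classical
  have h1 := hU.ae_le (fun ω => if ω ∈ C then c else ⊤)
    (Measurable.ite hC measurable_const measurable_const) (Eventually.of_forall fun ω => by
      by_cases hω : ω ∈ C
      · simpa [hω] using h ω hω
      · simp [hω])
  filter_upwards [h1] with ω hω hωC
  simpa [hωC] using hω

theorem ae_of_ae_on_large_sets [IsProbabilityMeasure P] {p : Ω → Prop}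
    (h : ∀ ε : ℝ, 0 < ε → ∃ A : Set Ω, MeasurableSet A ∧ 1 - ε ≤ P.real A ∧
      ∀ᵐ ω ∂P, ω ∈ A → p ω) : ∀ᵐ ω ∂P, p ω := by
  rw [ae_iff]
  refine (measureReal_eq_zero_iff (measure_ne_top _ _)).1 (le_antisymm
    (le_of_forall_pos_le_add fun ε hε => ?_) measureReal_nonneg)
  obtain ⟨A, hA, hPA, hp⟩ := h ε hε
  have hsub : {ω | ¬p ω} ⊆ Aᶜ ∪ {ω | ¬(ω ∈ A → p ω)} := by
    intro ω hω
    by_cases hωA : ω ∈ A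
    · exact Or.inr fun h' => hω (h' hωA)
    · exact Or.inl hωA
  have h0 : P.real {ω | ¬(ω ∈ A → p ω)} = 0 :=
    (measureReal_eq_zero_iff (measure_ne_top _ _)).2 (ae_iff.1 hp)
  calc P.real {ω | ¬p ω} ≤ P.real Aᶜ + P.real {ω | ¬(ω ∈ A → p ω)} :=
        (measureReal_mono hsub).trans (measureReal_union_le _ _)
    _ ≤ 0 + ε := by
        rw [h0]
        linarith [measureReal_compl_le hA hPA]

theorem LocallyUniformCondition.convergesOuterAlmostSurely [IsProbabilityMeasure P]
    (h : LocallyUniformCondition P Dn gn g S) (hS : MeasurableSet S) (hXn : ∀ n ω, Xn n ω ∈ Dn n ω)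
    {X : Ω → D} (hX : ∀ ω, X ω ∈ D₀) (hXm : Measurable X) (hXS : ∀ᵐ ω ∂P, X ω ∈ S)
    (has : ConvergesOuterAlmostSurely P Xn X) :
    ConvergesOuterAlmostSurely P (fun n ω => gn n ω ⟨Xn n ω, hXn n ω⟩)
      (fun ω => g ⟨X ω, hX ω⟩) := by
  obtain ⟨Δ, hΔ, hΔlim⟩ := has
  choose Θ hΘ using fun n => exists_isMinimalMajorant P
    (fun ω => ((dist (gn n ω ⟨Xn n ω, hXn n ω⟩) (g ⟨X ω, hX ω⟩) : ℝ) : EReal))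
  refine ⟨Θ, hΘ, ?_⟩
  have hδ : ∀ δ : ℝ, 0 < δ → ∀ᵐ ω ∂P, ∀ᶠ n in atTop, Θ n ω ≤ (δ : EReal) := by
    intro δ hδ
    refine ae_of_ae_on_large_sets fun ε hε => ?_
    obtain ⟨A, hA, hPA, hL⟩ := h.2 ε hε
    refine ⟨A, hA, hPA, ?_⟩
    -- on the measurable set `C k n`, `n ≥ k`, the `n`th error is at most `δ`, hence so is its
    -- minimal majorant almost surely; almost every point of `A` lies in `C k n` for some `k` and
    -- all large `n`
    let C : ℕ → ℕ → Set Ω := fun k n => ((A ∩ {ω | X ω ∈ S}) ∩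
      {ω | (⟨X ω, hX ω⟩ : D₀) ∈ deviationSet gn g A S δ k}ᶜ) ∩
        {ω | Δ n ω < ((1 / ((k : ℝ) + 1) : ℝ) : EReal)}
    have hC : ∀ k n, MeasurableSet (C k n) := fun k n =>
      ((hA.inter (hXm hS)).inter
        (measurableSet_preimage_deviationSet hS h.1 hX hXm δ k).compl).inter
          (measurableSet_lt (hΔ n).measurable measurable_const)
    have hae : ∀ᵐ ω ∂P, ∀ k n, k ≤ n → ω ∈ C k n → Θ n ω ≤ (δ : EReal) := by
      refine ae_all_iff.2 fun k => ae_all_iff.2 fun n => ?_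
      by_cases hkn : k ≤ n
      · filter_upwards [(hΘ n).ae_le_const_on (hC k n) (c := (δ : EReal)) (by
          rintro ω ⟨⟨⟨hωA, hωS⟩, hωk⟩, hωΔ⟩
          refine EReal.coe_le_coe_iff.2 (dist_le_of_notMem_deviationSet hX hXn hkn hωA hωS hωk ?_)
          exact EReal.coe_lt_coe_iff.1 (((hΔ n).le ω).trans_lt hωΔ))] with ω hω _
        exact hω
      · exact Eventually.of_forall fun ω h' => absurd h' hkn
    filter_upwards [hae, hXS, hΔlim] with ω hω hωS hωΔ hωA
    obtain ⟨k, hk⟩ := exists_notMem_deviationSet hδ (hL ⟨X ω, hX ω⟩)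
    have hpos : (0 : EReal) < ((1 / ((k : ℝ) + 1) : ℝ) : EReal) :=
      EReal.coe_pos.2 (by positivity)
    filter_upwards [eventually_ge_atTop k, hωΔ.eventually_lt_const hpos] with n hkn hn
    exact hω k n hkn ⟨⟨⟨hωA, hωS⟩, hk⟩, hn⟩
  have hall : ∀ᵐ ω ∂P, ∀ i : ℕ, ∀ᶠ n in atTop, Θ n ω ≤ ((1 / ((i : ℝ) + 1) : ℝ) : EReal) :=
    ae_all_iff.2 fun i => hδ _ (by positivity)
  filter_upwards [hall] with ω hω
  refine tendsto_order.2 ⟨fun a ha => Eventually.of_forall fun n => ha.trans_le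
    ((EReal.coe_nonneg.2 dist_nonneg).trans ((hΘ n).le ω)), fun a ha => ?_⟩
  obtain ⟨r, hr, hra⟩ := EReal.lt_iff_exists_real_btwn.1 ha
  obtain ⟨i, hi⟩ := exists_nat_one_div_lt (EReal.coe_pos.1 hr)
  filter_upwards [hω i] with n hn
  exact (hn.trans_lt (EReal.coe_lt_coe_iff.2 hi)).trans hra

end Core

/-! ### The limit domain of a sequence of sets -/

section LimitDomain

variable {D : Type*} [MetricSpace D] {Dn : ℕ → Set D}

/-- The set of limits of convergent sequences `x n ∈ Dn n` (for nonempty sets `Dn n`), described by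
the vanishing of the distances to `Dn n`. -/
def limitDomain (Dn : ℕ → Set D) : Set D :=
  {x | Tendsto (fun n => Metric.infDist x (Dn n)) atTop (𝓝 0)}

theorem measurableSet_limitDomain [MeasurableSpace D] [BorelSpace D] (Dn : ℕ → Set D) :
    MeasurableSet (limitDomain Dn) :=
  measurableSet_tendsto (𝓝 0) fun _ => measurable_infDist

theorem exists_seq_tendsto_of_mem_limitDomain (hne : ∀ n, (Dn n).Nonempty) {x : D}
    (hx : x ∈ limitDomain Dn) :
    ∃ z : (n : ℕ) → Dn n, Tendsto (fun n => (z n : D)) atTop (𝓝 x) := by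
  have h : ∀ n : ℕ, ∃ y ∈ Dn n, dist x y < Metric.infDist x (Dn n) + 1 / ((n : ℝ) + 1) := fun n =>
    (Metric.infDist_lt_iff (hne n)).1 (lt_add_of_pos_right _ (by positivity))
  choose y hy hxy using h
  refine ⟨fun n => ⟨y n, hy n⟩, tendsto_iff_dist_tendsto_zero.2
    (squeeze_zero (fun _ => dist_nonneg) (fun n => ?_)
      (by simpa only [add_zero] using hx.add tendsto_one_div_add_atTop_nhds_zero_nat))⟩
  rw [dist_comm]
  exact (hxy n).le

/-- A convergent sequence along a subsequence of the domains can be completed to a convergent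
sequence along all domains, provided its limit lies in the limit domain. -/
theorem exists_extension_of_subseq (hne : ∀ n, (Dn n).Nonempty) {x : D} (hx : x ∈ limitDomain Dn)
    {φ : ℕ → ℕ} (hφ : StrictMono φ) (y : (m : ℕ) → Dn (φ m))
    (hy : Tendsto (fun m => (y m : D)) atTop (𝓝 x)) :
    ∃ z : (n : ℕ) → Dn n, (∀ m, z (φ m) = y m) ∧ Tendsto (fun n => (z n : D)) atTop (𝓝 x) := by
  obtain ⟨z₀, hz₀⟩ := exists_seq_tendsto_of_mem_limitDomain hne hx
  have h : ∀ n, ∃ z : Dn n, (∀ m, φ m = n → (z : D) = y m) ∧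
      ((∃ m, φ m = n) ∨ z = z₀ n) := by
    intro n
    by_cases hn : ∃ m, φ m = n
    · obtain ⟨m, rfl⟩ := hn
      exact ⟨y m, fun m' hm' => by rw [hφ.injective hm'], Or.inl ⟨m, rfl⟩⟩
    · exact ⟨z₀ n, fun m hm => absurd ⟨m, hm⟩ hn, Or.inr rfl⟩
  choose z hzy hz using h
  refine ⟨z, fun m => Subtype.ext (hzy (φ m) m rfl), Metric.tendsto_atTop'.2 fun ε hε => ?_⟩
  obtain ⟨N, hN⟩ := Metric.tendsto_atTop'.1 hy ε hε
  obtain ⟨M, hM⟩ := Metric.tendsto_atTop'.1 hz₀ ε hε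
  refine ⟨max M (φ N), fun n hn => ?_⟩
  rcases hz n with ⟨m, rfl⟩ | h0
  · rw [hzy (φ m) m rfl]
    exact hN m (hφ.lt_iff_lt.1 ((le_max_right _ _).trans_lt hn))
  · rw [h0]
    exact hM n ((le_max_left _ _).trans_lt hn)

/-- By separability it suffices, for `X` to lie in the limit domain almost surely, that `X` avoids
each ball that keeps a positive distance from infinitely many `Dn n`: countably many such balls
cover the complement. -/
theorem ae_mem_limitDomain_of_ball {Ω : Type*} [MeasurableSpace Ω] {P : Measure Ω}
    [MeasurableSpace D] {X : Ω → D} (hsep : IsSeparableVariable P X)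
    (h : ∀ (c : D) (r : ℝ), 0 < r → (∃ᶠ n in atTop, r ≤ Metric.infDist c (Dn n)) →
      ∀ᵐ ω ∂P, X ω ∉ Metric.ball c (r / 2)) :
    ∀ᵐ ω ∂P, X ω ∈ limitDomain Dn := by
  obtain ⟨B, -, ⟨t, htc, hBt⟩, hXB⟩ := hsep
  have hall : ∀ᵐ ω ∂P, ∀ c ∈ t, ∀ j : ℕ,
      (∃ᶠ n in atTop, 1 / ((j : ℝ) + 1) ≤ Metric.infDist c (Dn n)) →
        X ω ∉ Metric.ball c (1 / ((j : ℝ) + 1) / 2) := by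
    refine (ae_ball_iff htc).2 fun c _ => ae_all_iff.2 fun j => ?_
    by_cases hj : ∃ᶠ n in atTop, 1 / ((j : ℝ) + 1) ≤ Metric.infDist c (Dn n)
    · filter_upwards [h c _ (by positivity) hj] with ω hω _ using hω
    · exact Eventually.of_forall fun ω hj' => absurd hj' hj
  filter_upwards [hall, hXB] with ω hω hωB
  refine tendsto_order.2 ⟨fun a ha => Eventually.of_forall fun n =>
    ha.trans_le Metric.infDist_nonneg, fun a ha => ?_⟩
  by_contra hfreq
  obtain ⟨j, hj⟩ := exists_nat_one_div_lt (half_pos ha)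
  have hj0 : 0 < 1 / ((j : ℝ) + 1) := by positivity
  obtain ⟨c, hct, hc⟩ := Metric.mem_closure_iff.1 (hBt hωB) _ (half_pos hj0)
  refine hω c hct j ?_ (Metric.mem_ball.2 hc)
  refine (not_eventually.1 hfreq).mono fun n hn => ?_
  have := Metric.infDist_le_infDist_add_dist (s := Dn n) (x := X ω) (y := c)
  linarith [not_lt.1 hn]

/-- If infinitely many `Xn n` avoid a ball, then the cone function supported on the ball has
expectation zero under the weak limit. -/
theorem ae_mem_limitDomain_of_weaklyConverges {Ω Ω' : Type*} [MeasurableSpace Ω] {P : Measure Ω}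
    [IsFiniteMeasure P] [MeasurableSpace Ω'] {P' : Measure Ω'} [IsFiniteMeasure P']
    [MeasurableSpace D] [BorelSpace D] {Xn : ℕ → Ω → D} (hXn : ∀ n ω, Xn n ω ∈ Dn n)
    {X : Ω' → D} (hXm : Measurable X) (hsep : IsSeparableVariable P' X)
    (hw : WeaklyConverges P Xn P' X) : ∀ᵐ ω ∂P', X ω ∈ limitDomain Dn := by
  refine ae_mem_limitDomain_of_ball hsep fun c r hr hfreq => ?_
  have hcont : Continuous fun x : D => max 0 (r - dist x c) := by fun_prop
  have hbd : ∀ x : D, |max 0 (r - dist x c)| ≤ r := fun x => by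
    rw [abs_of_nonneg (le_max_left _ _)]
    exact max_le hr.le (by linarith [dist_nonneg (x := x) (y := c)])
  have hlim := weaklyConverges_iff_outerMean.1 hw
    (BoundedContinuousFunction.ofNormedAddCommGroup _ hcont r hbd)
  simp only [BoundedContinuousFunction.coe_ofNormedAddCommGroup] at hlim
  have hzero : ∃ᶠ n in atTop, outerMean P (fun ω => max 0 (r - dist (Xn n ω) c)) ≤ 0 := by
    refine hfreq.mono fun n hn => ?_
    have h0 : ∀ ω, max 0 (r - dist (Xn n ω) c) ≤ 0 := fun ω => by
      refine max_le le_rfl ?_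
      have := Metric.infDist_le_dist_of_mem (x := c) (hXn n ω)
      rw [dist_comm] at this
      linarith
    simpa using outerMean_le_integral (P := P) (v := fun _ => 0) (fun ω => hbd (Xn n ω))
      measurable_const (integrable_const _) h0
  have hint : ∫ ω, max 0 (r - dist (X ω) c) ∂P' = 0 :=
    le_antisymm (le_of_tendsto_of_frequently hlim hzero) (integral_nonneg fun ω => le_max_left _ _)
  have hae := (integral_eq_zero_iff_of_nonneg (fun ω => le_max_left _ _)
    (integrable_of_abs_le (hcont.measurable.comp hXm).aemeasurable fun ω => hbd (X ω))).1 hint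
  filter_upwards [hae] with ω hω hball
  have h1 : max 0 (r - dist (X ω) c) = 0 := hω
  have h2 := max_eq_left_iff.1 h1
  linarith [Metric.mem_ball.1 hball]

theorem ae_mem_limitDomain_of_convergesInOuterProbability {Ω : Type*} [MeasurableSpace Ω]
    {P : Measure Ω} [MeasurableSpace D] {Xn : ℕ → Ω → D} (hXn : ∀ n ω, Xn n ω ∈ Dn n)
    {X : Ω → D} (hsep : IsSeparableVariable P X) (hp : ConvergesInOuterProbability P Xn X) :
    ∀ᵐ ω ∂P, X ω ∈ limitDomain Dn := by
  refine ae_mem_limitDomain_of_ball hsep fun c r hr hfreq => ?_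
  have hle : ∃ᶠ n in atTop, P {ω | X ω ∈ Metric.ball c (r / 2)} ≤
      P {ω | r / 4 < dist (Xn n ω) (X ω)} := by
    refine hfreq.mono fun n hn => measure_mono fun ω hω => ?_
    have h1 := Metric.infDist_le_dist_of_mem (x := c) (hXn n ω)
    have h2 := dist_triangle c (X ω) (Xn n ω)
    have h3 : dist c (X ω) < r / 2 := Metric.mem_ball'.1 hω
    rw [dist_comm (X ω)] at h2
    change r / 4 < dist (Xn n ω) (X ω)
    linarith
  refine measure_eq_zero_iff_ae_notMem.1 (le_antisymm ?_ zero_le)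
  exact ge_of_tendsto_of_frequently (hp (r / 4) (by positivity)) hle

theorem ae_mem_limitDomain_of_convergesOuterAlmostSurely {Ω : Type*} [MeasurableSpace Ω]
    {P : Measure Ω} {Xn : ℕ → Ω → D} (hXn : ∀ n ω, Xn n ω ∈ Dn n)
    {X : Ω → D} (has : ConvergesOuterAlmostSurely P Xn X) :
    ∀ᵐ ω ∂P, X ω ∈ limitDomain Dn := by
  obtain ⟨Δ, hΔ, hlim⟩ := has
  filter_upwards [hlim] with ω hω
  refine tendsto_order.2 ⟨fun a ha => Eventually.of_forall fun n =>
    ha.trans_le Metric.infDist_nonneg, fun a ha => ?_⟩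
  filter_upwards [hω.eventually_lt_const (EReal.coe_pos.2 ha)] with n hn
  refine (Metric.infDist_le_dist_of_mem (hXn n ω)).trans_lt ?_
  rw [dist_comm]
  exact EReal.coe_lt_coe_iff.1 (((hΔ n).le ω).trans_lt hn)

end LimitDomain

/-! ### The two conditions on the random maps -/

section Conditions

variable {Ω D E : Type*} [MeasurableSpace Ω] {P : Measure Ω} [MetricSpace D] [MetricSpace E]
  {D₀ : Set D} {g : D₀ → E}

/-- Random domains: subsequential convergence gives local uniform convergence everywhere on `D₀`. -/
theorem RandomDomainCondition.locallyUniformCondition {Dn : ℕ → Ω → Set D}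
    {gn : (n : ℕ) → (ω : Ω) → Dn n ω → E} (h : RandomDomainCondition P Dn gn D₀ g) :
    LocallyUniformCondition P Dn gn g Set.univ := by
  refine ⟨h.1.continuousOn, fun ε hε => ?_⟩
  obtain ⟨A, hA, hPA, hseq⟩ := h.2 ε hε
  exact ⟨A, hA, hPA, fun x₀ _ => .of_seq fun φ hφ w hw x hx => hseq φ hφ w hw x x₀ hx⟩

/-- Fixed domains: local uniform convergence holds on the limit domain, and it makes `g` continuous
there. -/
theorem FixedDomainCondition.locallyUniformCondition [IsProbabilityMeasure P] {Dn : ℕ → Set D}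
    {gn : (n : ℕ) → Ω → Dn n → E} (hne : ∀ n, (Dn n).Nonempty)
    (h : FixedDomainCondition P Dn gn D₀ g) :
    LocallyUniformCondition P (fun n _ => Dn n) gn g (limitDomain Dn) := by
  have hloc : ∀ ε : ℝ, 0 < ε → ∃ A : Set Ω, MeasurableSet A ∧ 1 - ε ≤ P.real A ∧
      (∀ (x : (n : ℕ) → Dn n) (x₀ : D₀), Tendsto (fun n => (x n : D)) atTop (𝓝 (x₀ : D)) →
        TendstoUniformlyOn (fun n ω => gn n ω (x n)) (fun _ => g x₀) atTop A) ∧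
      ∀ x₀ : D₀, (x₀ : D) ∈ limitDomain Dn →
        LocallyUniformAt (fun n _ => Dn n) gn g A x₀ := by
    intro ε hε
    obtain ⟨A, hA, hPA, hunif⟩ := h ε hε
    refine ⟨A, hA, hPA, hunif, fun x₀ hx₀ => .of_seq fun φ hφ w hw x hx => ?_⟩
    obtain ⟨z, hzx, hz⟩ := exists_extension_of_subseq hne hx₀ hφ x hx
    refine Metric.tendsto_nhds.2 fun η hη => ?_
    filter_upwards [hφ.tendsto_atTop.eventually
      (Metric.tendstoUniformlyOn_iff.1 (hunif z x₀ hz) η hη)] with m hm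
    rw [dist_comm, ← hzx m]
    exact hm (w m) (hw m)
  refine ⟨fun x₀ hx₀ => ?_, fun ε hε => ?_⟩
  -- values of `g` near `x₀` are limits of values of `gn n ω`, for a single `ω`, near `x₀`
  · obtain ⟨A, -, hPA, hunif, hL⟩ := hloc (1 / 2) (by norm_num)
    obtain ⟨ω, hω⟩ : A.Nonempty :=
      nonempty_of_measureReal_ne_zero (μ := P) (by linarith : (0 : ℝ) < P.real A).ne'
    refine Metric.tendsto_nhds.2 fun η hη => ?_
    obtain ⟨k, hk⟩ := hL x₀ hx₀ (η / 2) (half_pos hη)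
    have hball : ∀ᶠ x : D₀ in 𝓝 x₀, dist x x₀ < 1 / ((k : ℝ) + 1) :=
      Metric.ball_mem_nhds x₀ (by positivity)
    filter_upwards [nhdsWithin_le_nhds hball, self_mem_nhdsWithin] with x hx hxS
    obtain ⟨z, hz⟩ := exists_seq_tendsto_of_mem_limitDomain hne hxS
    have h1 : Tendsto (fun n => dist (gn n ω (z n)) (g x₀)) atTop (𝓝 (dist (g x) (g x₀))) :=
      ((hunif z x hz).tendsto_at hω).dist tendsto_const_nhds
    have h2 : ∀ᶠ n in atTop, dist (z n : D) x₀ < 1 / ((k : ℝ) + 1) :=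
      (hz.dist tendsto_const_nhds).eventually_lt_const hx
    refine lt_of_le_of_lt (le_of_tendsto h1 ?_) (half_lt_self hη)
    filter_upwards [h2, eventually_ge_atTop k] with n hn hkn
    exact (hk n hkn ω hω (z n) hn).le
  · obtain ⟨A, hA, hPA, -, hL⟩ := hloc ε hε
    exact ⟨A, hA, hPA, hL⟩

end Conditions

end ExtCMT

theorem mainTheorem4
    {Ω Ω' D E : Type*}
    [MeasurableSpace Ω] (P : Measure Ω) [IsProbabilityMeasure P]
    [MeasurableSpace Ω'] (P' : Measure Ω') [IsProbabilityMeasure P']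
    [MetricSpace D] [MeasurableSpace D] [BorelSpace D]
    [MetricSpace E] [MeasurableSpace E] [BorelSpace E]
    (D₀ : Set D) (g : D₀ → E) (Xn : ℕ → Ω → D) :
    -- fixed domains, separable limit
    (∀ (Dn : ℕ → Set D) (gn : (n : ℕ) → Ω → Dn n → E) (hXn : ∀ n ω, Xn n ω ∈ Dn n),
      ExtCMT.FixedDomainCondition P Dn gn D₀ g →
      (∀ (X : Ω' → D) (hX : ∀ ω, X ω ∈ D₀), Measurable X →
        ExtCMT.IsSeparableVariable P' X →
        ExtCMT.WeaklyConverges P Xn P' X →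
          AEMeasurable (fun ω => g ⟨X ω, hX ω⟩) P' ∧
          ExtCMT.WeaklyConverges P (fun n ω => gn n ω ⟨Xn n ω, hXn n ω⟩)
            P' (fun ω => g ⟨X ω, hX ω⟩)) ∧
      (∀ (X : Ω → D) (hX : ∀ ω, X ω ∈ D₀), Measurable X →
        ExtCMT.IsSeparableVariable P X →
        (ExtCMT.ConvergesInOuterProbability P Xn X →
          ExtCMT.ConvergesInOuterProbability P (fun n ω => gn n ω ⟨Xn n ω, hXn n ω⟩)
            (fun ω => g ⟨X ω, hX ω⟩)) ∧
        (ExtCMT.ConvergesOuterAlmostSurely P Xn X →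
          ExtCMT.ConvergesOuterAlmostSurely P (fun n ω => gn n ω ⟨Xn n ω, hXn n ω⟩)
            (fun ω => g ⟨X ω, hX ω⟩)))) ∧
    -- random domains, continuous limit map
    (∀ (Dn : ℕ → Ω → Set D) (gn : (n : ℕ) → (ω : Ω) → Dn n ω → E)
        (hXn : ∀ n ω, Xn n ω ∈ Dn n ω),
      ExtCMT.RandomDomainCondition P Dn gn D₀ g →
      (∀ (X : Ω' → D) (hX : ∀ ω, X ω ∈ D₀), Measurable X →
        ExtCMT.WeaklyConverges P Xn P' X →
          Measurable (fun ω => g ⟨X ω, hX ω⟩) ∧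
          ExtCMT.WeaklyConverges P (fun n ω => gn n ω ⟨Xn n ω, hXn n ω⟩)
            P' (fun ω => g ⟨X ω, hX ω⟩)) ∧
      (∀ (X : Ω → D) (hX : ∀ ω, X ω ∈ D₀), Measurable X →
        (ExtCMT.ConvergesInOuterProbability P Xn X →
          ExtCMT.ConvergesInOuterProbability P (fun n ω => gn n ω ⟨Xn n ω, hXn n ω⟩)
            (fun ω => g ⟨X ω, hX ω⟩)) ∧
        (ExtCMT.ConvergesOuterAlmostSurely P Xn X →
          ExtCMT.ConvergesOuterAlmostSurely P (fun n ω => gn n ω ⟨Xn n ω, hXn n ω⟩)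
            (fun ω => g ⟨X ω, hX ω⟩)))) := by

  have hΩ : Nonempty Ω := nonempty_of_isProbabilityMeasure P
  refine ⟨fun Dn gn hXn hc => ?_, fun Dn gn hXn hc => ?_⟩
  · have hL := hc.locallyUniformCondition fun n => ⟨_, hXn n hΩ.some⟩
    have hS := ExtCMT.measurableSet_limitDomain Dn
    refine ⟨fun X hX hXm hsep hw => ?_, fun X hX hXm hsep => ⟨fun hp => ?_, fun has => ?_⟩⟩
    · have hXS := ExtCMT.ae_mem_limitDomain_of_weaklyConverges hXn hXm hsep hw
      exact ⟨ExtCMT.aemeasurable_comp_of_continuousOn hS hL.1 hX hXm hXS,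
        hL.weaklyConverges hS hXn hX hXm hXS hw⟩
    · exact hL.convergesInOuterProbability hS hXn hX hXm
        (ExtCMT.ae_mem_limitDomain_of_convergesInOuterProbability hXn hsep hp) hp
    · exact hL.convergesOuterAlmostSurely hS hXn hX hXm
        (ExtCMT.ae_mem_limitDomain_of_convergesOuterAlmostSurely hXn has) has
  · have hL := hc.locallyUniformCondition
    refine ⟨fun X hX hXm hw => ⟨hc.1.measurable.comp hXm.subtype_mk, ?_⟩,
      fun X hX hXm => ⟨fun hp => ?_, fun has => ?_⟩⟩
    · exact hL.weaklyConverges .univ hXn hX hXm (by simp) hw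
    · exact hL.convergesInOuterProbability .univ hXn hX hXm (by simp) hp
    · exact hL.convergesOuterAlmostSurely .univ hXn hX hXm (by simp) has
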